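/- **Conventions.** A semi-Markovian graph (SMG) $G$ on a finite set $V$ of observed variables consists of an acyclic set of directed edges and a set of bidirected edges between distinct vertices. A semi-Markovian causal model $M$ over $V$ has finitely many mutually independent unobserved variables $U$ (with arbitrary domains), observed variables $v\in V$ with nonempty countable discrete domains, and for each $v\in V$ a (measurable) function $f_v$ that determines $v$ from a set of observed and a set of unobserved arguments; each $U$ is an argument of at most two of these functions, and the relation "$a$ is an argument of $f_b$" on $V$ is acyclic. $M$ induces $G$ if, for all $a,b\in V$, $a\to b$ in $G$ iff $a$ is an argument of $f_b$, and $a\leftrightarrow b$ in $G$ iff $a\ne b$ and $f_a$, $f_b$ share an unobserved argument. $P$ denotes the distribution of the observed variables in $M$, $P(S)$ its marginal on $S\subseteq V$, and $P_{x}(y)$ the probability of $Y=y$ after replacing, for every $v\in X$, the function $f_v$ by the constant $x_v$. The effect of $X$ on $Y$ is identifiable from $P$ in $G$ if any two models that induce $G$ and have the same, everywhere positive, observed distribution have the same $P_x(y)$ for all values $x,y$. $\mathrm{An}(Y)_G$ is $Y$ together with all its ancestors, and $G[S]$ is the induced subgraph, which retains both the directed and the bidirected edges inside $S$. **Theorem.**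 Let $G$ be an SMG on $V$, let $X,Y\subseteq V$ be disjoint with $G=G[\mathrm{An}(Y)_G]$, let $Z\subseteq V$ satisfy $Z\cap(X\cup Y)=\emptyset$, and let $W\in V\setminus Z$. Suppose that $Z$ is connected to $V\setminus Z$ only through $W$, i.e. every path between a vertex of $Z$ and a vertex of $V\setminus Z$ (ignoring edge directions and using directed and bidirected edges) contains $W$. Then $P_x(y)$ obtained from $P$ in $G$ is equal to $P'_x(y)$ obtained from $P'=P(V\setminus Z)$ in $G[V\setminus Z]$, in the following sense. 1. For every model $M$ that induces $G$, with observed distribution $P$, there is a model $M'$ that induces $G[V\setminus Z]$, whose observed distribution is $P'=P(V\setminus Z)$ and whose effect satisfies $P'_x(y)=P_x(y)$ for all values $x,y$. 2. The effect of $X$ on $Y$ is identifiable from $P$ in $G$ if and only if it is identifiable from $P'$ in $G[V\setminus Z]$. 3. If it is identifiable, then for every model $M$ that induces $G$ and has a positive observed distribution $P$, and every model $M'$ that induces $G[V\setminus Z]$ and has the observed distribution $P'=P(V\setminus Z)$, one has $P_x(y)=P'_x(y)$ for all values $x,y$. -/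

import Mathlib

open Set MeasureTheory
open scoped ENNReal

universe u

/-- A semi-Markovian graph on the vertex set `V` of observed variables: an acyclic directed graph
together with bidirected edges (each standing for an unobserved common parent). -/
@[ext]
structure SMG (V : Type u) where
  /-- `dir a b` is the edge `a → b`. -/
  dir : V → V → Prop
  /-- `bidir a b` is the edge `a ↔ b`. -/
  bidir : V → V → Prop
  bidir_symm : ∀ a b, bidir a b → bidir b a
  bidir_irrefl : ∀ a, ¬ bidir a a
  acyclic : ∀ a, ¬ Relation.TransGen dir a a

namespace SMG

variable {V : Type u}

/-- The set `An(Y)_G`: the members of `Y` and their ancestors in `G`. -/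
def An (G : SMG V) (Y : Set V) : Set V :=
  {a | ∃ y ∈ Y, Relation.ReflTransGen G.dir a y}

/-- The induced subgraph `G[S]`; it keeps all directed and bidirected edges inside `S`. -/
def induce (G : SMG V) (S : Set V) : SMG S where
  dir a b := G.dir a b
  bidir a b := G.bidir a b
  bidir_symm a b h := G.bidir_symm a b h
  bidir_irrefl a h := G.bidir_irrefl a h
  acyclic a h := G.acyclic a (by
    have key : ∀ b : S, Relation.TransGen (fun a b : S => G.dir a b) a b →
        Relation.TransGen G.dir a b := fun b h => by
      induction h with
      | single h => exact Relation.TransGen.single h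
      | tail _ h ih => exact ih.tail h
    exact key a h)

/-- The undirected graph obtained by ignoring the type and orientation of the edges. -/
def skeleton (G : SMG V) : SimpleGraph V where
  Adj a b := G.dir a b ∨ G.dir b a ∨ G.bidir a b
  symm := ⟨fun a b h => by
    rcases h with h | h | h
    · exact Or.inr (Or.inl h)
    · exact Or.inl h
    · exact Or.inr (Or.inr (G.bidir_symm a b h))⟩
  loopless := ⟨fun a h => by
    rcases h with h | h | h
    · exact G.acyclic a (Relation.TransGen.single h)
    · exact G.acyclic a (Relation.TransGen.single h)
    · exact G.bidir_irrefl a h⟩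

/-- `Z` is connected to the remaining vertices only through the vertex `W`, which is itself
outside of `Z`: every path between `Z` and its complement, where the directions of the edges are
ignored and bidirected edges may be used, contains `W`. -/
def ConnectedOnlyThrough (G : SMG V) (Z : Set V) (W : V) : Prop :=
  W ∉ Z ∧ ∀ z ∈ Z, ∀ v ∉ Z, ∀ p : G.skeleton.Walk z v, W ∈ p.support

end SMG

/-- A semi-Markovian causal model with observed variables indexed by `V`, the variable `v` taking
values in `Ω v`. -/
structure SemiMarkovianModel {V : Type u} (Ω : V → Type) where
  /-- the index set of the unobserved variables -/
  U : Type
  [fintypeU : Fintype U]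
  /-- the domains of the unobserved variables -/
  N : U → Type
  [measurableN : ∀ i, MeasurableSpace (N i)]
  /-- the distributions of the unobserved variables -/
  law : ∀ i, Measure (N i)
  [probLaw : ∀ i, IsProbabilityMeasure (law i)]
  /-- the observed variables in terms of which the function of `v` is defined -/
  pa : V → Set V
  /-- the unobserved variables in terms of which the function of `v` is defined -/
  upa : V → Set U
  /-- the function that determines `v` -/
  f : ∀ v, (∀ p : pa v, Ω p) → (∀ i : upa v, N i) → Ω v
  measurable_f : ∀ v (a : ∀ p : pa v, Ω p) (w : Ω v), MeasurableSet {n | f v a n = w}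
  /-- every unobserved variable appears in at most two functions -/
  upa_card : ∀ i, {v | i ∈ upa v}.encard ≤ 2
  acyclic : ∀ v, ¬ Relation.TransGen (fun a b => a ∈ pa b) v v

namespace SemiMarkovianModel

variable {V : Type u} {Ω : V → Type}

attribute [instance] SemiMarkovianModel.fintypeU SemiMarkovianModel.measurableN
  SemiMarkovianModel.probLaw

/-- The semi-Markovian graph induced by the model. -/
def graph (M : SemiMarkovianModel Ω) : SMG V where
  dir a b := a ∈ M.pa b
  bidir a b := a ≠ b ∧ ∃ i, i ∈ M.upa a ∧ i ∈ M.upa b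
  bidir_symm := fun _ _ ⟨h, i, ha, hb⟩ => ⟨h.symm, i, hb, ha⟩
  bidir_irrefl := fun _ h => h.1 rfl
  acyclic := M.acyclic

/-- The joint distribution of the (mutually independent) unobserved variables. -/
noncomputable def noise (M : SemiMarkovianModel Ω) : Measure (∀ i, M.N i) :=
  Measure.pi M.law

theorem wellFounded_pa [Finite V] (M : SemiMarkovianModel Ω) :
    WellFounded (fun a b => a ∈ M.pa b) := by
  have : IsTrans V (Relation.TransGen fun a b => a ∈ M.pa b) :=
    ⟨fun _ _ _ h h' => h.trans h'⟩
  have : Std.Irrefl (Relation.TransGen fun a b => a ∈ M.pa b) := ⟨M.acyclic⟩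
  exact Subrelation.wf (r := Relation.TransGen fun a b => a ∈ M.pa b)
    (fun h => Relation.TransGen.single h) (Finite.wellFounded_of_trans_of_irrefl _)

open Classical in
/-- The values of the observed variables in the sub-model obtained by the intervention `do(x)` on
`X`, when the unobserved variables have the value `n`: the function of each `v ∈ X` is replaced by
the constant `x v`. Only the coordinates of `x` in `X` matter. -/
noncomputable def solution [Finite V] (M : SemiMarkovianModel Ω) (X : Set V) (x : ∀ v, Ω v)
    (n : ∀ i, M.N i) : ∀ v, Ω v :=
  M.wellFounded_pa.fix fun v ih =>
    if v ∈ X then x v else M.f v (fun p => ih p p.2) (fun i => n i)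

open Classical in
theorem solution_eq [Finite V] (M : SemiMarkovianModel Ω) (X : Set V) (x : ∀ v, Ω v)
    (n : ∀ i, M.N i) (v : V) :
    M.solution X x n v =
      if v ∈ X then x v else M.f v (fun p => M.solution X x n p) (fun i => n i) :=
  M.wellFounded_pa.fix_eq _ v

/-- The probability `P_x(y)` that `Y` takes the value `y` under the intervention `do(X = x)`. Only
the coordinates of `x` in `X` and of `y` in `Y` matter. -/
noncomputable def effect [Finite V] (M : SemiMarkovianModel Ω) (X : Set V) (x : ∀ v, Ω v)
    (Y : Set V) (y : ∀ v, Ω v) : ℝ≥0∞ :=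
  M.noise {n | ∀ v ∈ Y, M.solution X x n v = y v}

/-- The observational probability `P(S = s)`, that is, without any intervention. As a function of
`s` it is the (marginal) distribution `P(S)`; the joint distribution is `P(V)`. -/
noncomputable def obs [Finite V] (M : SemiMarkovianModel Ω) (S : Set V) (s : ∀ v, Ω v) : ℝ≥0∞ :=
  M.effect ∅ s S s

end SemiMarkovianModel

/-- The causal effect of `X` on `Y` is identifiable from `P` in `G`: any two causal models that
induce `G` and have the same, positive, joint distribution of the observed variables (with any
countable discrete domains) agree on `P_x(y)` for all values `x` and `y`. -/
def Identifiable {V : Type u} [Finite V] (G : SMG V) (X Y : Set V) : Prop :=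
  ∀ (Ω : V → Type) [∀ v, Countable (Ω v)] [∀ v, Nonempty (Ω v)] (M₁ M₂ : SemiMarkovianModel Ω),
    M₁.graph = G → M₂.graph = G →
    (∀ v, 0 < M₁.obs univ v) → (∀ v, M₁.obs univ v = M₂.obs univ v) →
    ∀ x y, M₁.effect X x Y y = M₂.effect X x Y y

/-! ### Edges between `Z` and its complement -/

namespace SMG

variable {V : Type u} {G : SMG V} {Z : Set V} {W : V}

/-! Every vertex of `Z` has a descendant in `Y`, and a directed path can leave `Z` only into `W`, so
every vertex of `Z` is an ancestor of `W`. An edge into `Z` from outside would have to start at `W`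
and would close a cycle. Hence `Z` is closed under parents (`ConnectedOnlyThrough.mem_of_dir`), and
it influences the rest only through the function of `W`.

From `G` to `G[V \ Z]`: substitute the functions of `Z` into that of `W`, handing the noise of `Z`
to `W`. No other outside vertex uses that noise, so the graph is the induced one, and all solutions
outside `Z` are unchanged (`marginal_graph`, `marginal_solution`). Comparing this marginal model
with any other model on `V \ Z` transfers identifiability up to `G` and gives the equality of the
two effects.

From `G[V \ Z]` to `G`: extend two models that agree observationally by the same independent, fully
supported variables on `Z`, ignored by everything else. The joint law is multiplied by a common
positive factor (`extension_obs`) and the effects do not change (`extension_effect`), so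
identifiability in `G` applies. -/

theorem ConnectedOnlyThrough.eq_of_adj (hW : G.ConnectedOnlyThrough Z W) {z v : V}
    (hz : z ∈ Z) (hv : v ∉ Z) (h : G.skeleton.Adj z v) : v = W := by
  have := hW.2 z hz v hv h.toWalk
  simp only [SimpleGraph.Walk.support_cons, SimpleGraph.Walk.support_nil, List.mem_cons,
    List.not_mem_nil, or_false] at this
  rcases this with rfl | rfl
  · exact absurd hz hW.1
  · rfl

theorem ConnectedOnlyThrough.eq_of_dir (hW : G.ConnectedOnlyThrough Z W) {z v : V}
    (hz : z ∈ Z) (hv : v ∉ Z) (h : G.dir z v) : v = W :=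
  hW.eq_of_adj hz hv (Or.inl h)

theorem ConnectedOnlyThrough.eq_of_bidir (hW : G.ConnectedOnlyThrough Z W) {z v : V}
    (hz : z ∈ Z) (hv : v ∉ Z) (h : G.bidir z v) : v = W :=
  hW.eq_of_adj hz hv (Or.inr (Or.inr h))

/-- A directed path that leaves `Z` leaves it through `W`. -/
theorem ConnectedOnlyThrough.reflTransGen (hW : G.ConnectedOnlyThrough Z W) {z y : V}
    (hz : z ∈ Z) (hy : y ∉ Z) (h : Relation.ReflTransGen G.dir z y) :
    Relation.ReflTransGen G.dir z W := by
  induction h using Relation.ReflTransGen.head_induction_on with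
  | refl => exact absurd hz hy
  | @head a c hac _ ih =>
    by_cases hc : c ∈ Z
    · exact (ih hc).head hac
    · rw [← hW.eq_of_dir hz hc hac]
      exact Relation.ReflTransGen.single hac

/-- If every vertex of `Z` has a descendant outside of `Z`, then no edge enters `Z`. -/
theorem ConnectedOnlyThrough.mem_of_dir (hW : G.ConnectedOnlyThrough Z W) {Y : Set V}
    (hAn : G.An Y = univ) (hYZ : Disjoint Z Y) {p z : V} (hz : z ∈ Z) (h : G.dir p z) :
    p ∈ Z := by
  by_contra hp
  obtain rfl := hW.eq_of_adj hz hp (Or.inr (Or.inl h))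
  obtain ⟨y, hy, hzy⟩ : z ∈ G.An Y := hAn ▸ mem_univ z
  -- Here `p` is `W`: the cycle consists of the edge `W → z` and a directed path from `z` back to
  -- `W`.
  exact G.acyclic p
    (Relation.TransGen.head' h (hW.reflTransGen hz (hYZ.notMem_of_mem_right hy) hzy))

end SMG

/-! ### Solutions, measurability and marginals of the observed law -/

namespace SemiMarkovianModel

variable {V : Type u} [Finite V] {Ω : V → Type}

theorem solution_of_mem (M : SemiMarkovianModel Ω) {X : Set V} {v : V} (hv : v ∈ X)
    (x : ∀ v, Ω v) (n : ∀ i, M.N i) : M.solution X x n v = x v :=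
  (M.solution_eq X x n v).trans (if_pos hv)

theorem solution_of_notMem (M : SemiMarkovianModel Ω) {X : Set V} {v : V} (hv : v ∉ X)
    (x : ∀ v, Ω v) (n : ∀ i, M.N i) :
    M.solution X x n v = M.f v (fun p => M.solution X x n p) (fun i => n i) :=
  (M.solution_eq X x n v).trans (if_neg hv)

/-- The solution on a set that is closed under taking parents and free of interventions depends
only on the unobserved arguments of the functions of that set. -/
theorem solution_congr (M : SemiMarkovianModel Ω) {A X X' : Set V} {x x' : ∀ v, Ω v}
    {n n' : ∀ i, M.N i} (hA : ∀ v ∈ A, M.pa v ⊆ A) (hX : Disjoint A X) (hX' : Disjoint A X')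
    (hn : ∀ v ∈ A, ∀ i ∈ M.upa v, n i = n' i) :
    ∀ v ∈ A, M.solution X x n v = M.solution X' x' n' v := by
  intro v
  induction v using M.wellFounded_pa.induction with
  | h v ih =>
    intro hv
    rw [M.solution_of_notMem (hX.notMem_of_mem_left hv),
      M.solution_of_notMem (hX'.notMem_of_mem_left hv)]
    congr 1
    · funext p
      exact ih p p.2 (hA v hv p.2)
    · funext i
      exact hn v hv i i.2

/-- `obs` passes its argument also as the inert intervention value; this lets that value be
exchanged when events for different arguments are compared. -/
theorem solution_empty (M : SemiMarkovianModel Ω) (x x' : ∀ v, Ω v) (n : ∀ i, M.N i) :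
    M.solution ∅ x n = M.solution ∅ x' n :=
  funext fun v => M.solution_congr (A := univ) (fun _ _ => subset_univ _) (disjoint_empty _)
    (disjoint_empty _) (fun _ _ _ _ => rfl) v (mem_univ v)

theorem measurableSet_solution [∀ v, Countable (Ω v)] (M : SemiMarkovianModel Ω) (X : Set V)
    (x : ∀ v, Ω v) (v : V) (w : Ω v) : MeasurableSet {n | M.solution X x n v = w} := by
  induction v using M.wellFounded_pa.induction with
  | h v ih =>
    by_cases hv : v ∈ X
    · simp only [M.solution_of_mem hv]
      exact MeasurableSet.const _
    -- Splitting by the parents' values reduces to `measurable_f`, which fixes these values; the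
    -- union is countable because there are finitely many parents with countable domains.
    · have : {n | M.solution X x n v = w} = ⋃ a : ∀ p : M.pa v, Ω p,
          (⋂ p : M.pa v, {n | M.solution X x n p = a p}) ∩
            (fun (n : ∀ i, M.N i) (i : M.upa v) => n i) ⁻¹' {n | M.f v a n = w} := by
        ext n
        simp only [M.solution_of_notMem hv, mem_ofPred_eq, mem_iUnion, mem_inter_iff,
          mem_iInter, mem_preimage]
        constructor
        · exact fun h => ⟨_, fun _ => rfl, h⟩
        · rintro ⟨a, ha, h⟩
          rwa [funext ha]
      rw [this]
      refine MeasurableSet.iUnion fun a => MeasurableSet.inter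
        (MeasurableSet.iInter fun p => ih p p.2 _) ?_
      exact (measurable_pi_lambda _ fun i => measurable_pi_apply _) (M.measurable_f v a w)

/-- The event splits into countably many disjoint events by the full configuration, so the joint law
determines every marginal. -/
theorem obs_eq_tsum [∀ v, Countable (Ω v)] (M : SemiMarkovianModel Ω) (S : Set V)
    (s : ∀ v, Ω v) :
    M.obs S s = ∑' t : {t : ∀ v, Ω v // ∀ v ∈ S, t v = s v}, M.obs univ t := by
  have : {n | ∀ v ∈ S, M.solution ∅ s n v = s v} =
      ⋃ t : {t : ∀ v, Ω v // ∀ v ∈ S, t v = s v},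
        {n | ∀ v ∈ univ, M.solution ∅ t n v = t.1 v} := by
    ext n
    simp only [mem_ofPred_eq, mem_iUnion, mem_univ, forall_true_left]
    constructor
    · exact fun h => ⟨⟨M.solution ∅ s n, h⟩, fun v => by rw [M.solution_empty _ s]⟩
    · rintro ⟨t, ht⟩ v hv
      rw [M.solution_empty s t, ht, t.2 v hv]
  rw [obs, effect, this, measure_iUnion]
  · rfl
  · intro t t' htt'
    refine Set.disjoint_left.mpr fun n hn hn' => htt' (Subtype.ext (funext fun v => ?_))
    rw [← hn v (mem_univ v), M.solution_empty t t', hn' v (mem_univ v)]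
  · intro t
    simp only [mem_univ, forall_true_left, ofPred_forall]
    exact MeasurableSet.iInter fun v => M.measurableSet_solution ∅ t v _

theorem obs_congr [∀ v, Countable (Ω v)] {M₁ M₂ : SemiMarkovianModel Ω}
    (h : ∀ v, M₁.obs univ v = M₂.obs univ v) (S : Set V) (s : ∀ v, Ω v) :
    M₁.obs S s = M₂.obs S s := by
  simp only [obs_eq_tsum _ S, h]

theorem obs_univ_le (M : SemiMarkovianModel Ω) (S : Set V) (s : ∀ v, Ω v) :
    M.obs univ s ≤ M.obs S s :=
  measure_mono fun _ hn v _ => hn v (mem_univ v)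

/-! ### Substituting `Z` into the function of `W` -/

section Marginal

variable (M : SemiMarkovianModel Ω) (Z : Set V) (W : V)

omit [Finite V] in
theorem nonempty_N (i : M.U) : Nonempty (M.N i) :=
  nonempty_of_isProbabilityMeasure (M.law i)

/-- The unobserved arguments of `v` when the functions of the members of `Z` are substituted into
the function of `W`. -/
def margUpa (v : V) : Set M.U :=
  M.upa v ∪ {i | v = W ∧ ∃ z ∈ Z, i ∈ M.upa z}

open Classical in
/-- Extend partial values of the unobserved variables by arbitrary values. -/
noncomputable def extendNoise (A : Set M.U) (n : ∀ i : A, M.N i) (i : M.U) : M.N i :=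
  if h : i ∈ A then n ⟨i, h⟩ else (M.nonempty_N i).some

omit [Finite V] in
theorem measurable_extendNoise (A : Set M.U) : Measurable (M.extendNoise A) := by
  refine measurable_pi_lambda _ fun i => ?_
  by_cases h : i ∈ A
  · simp only [extendNoise, dif_pos h]
    exact measurable_pi_apply _
  · simp only [extendNoise, dif_neg h]
    exact measurable_const

open Classical in
/-- The values of the parents of `v`, where those in `Z` are computed from the unobserved
variables. -/
noncomputable def margParents (x : ∀ v, Ω v) (v : V) (a : ∀ p : {p : ↥Zᶜ | p.1 ∈ M.pa v}, Ω p.1)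
    (n : ∀ i : M.margUpa Z W v, M.N i) (p : M.pa v) : Ω p :=
  if h : p.1 ∈ Z then M.solution ∅ x (M.extendNoise _ n) p else a ⟨⟨p.1, h⟩, p.2⟩

variable {M Z W} {Y : Set V}

omit [Finite V] in
theorem eq_of_mem_upa_of_mem_upa (hW : M.graph.ConnectedOnlyThrough Z W) {z v : V} (hz : z ∈ Z)
    (hv : v ∉ Z) {i : M.U} (hiz : i ∈ M.upa z) (hiv : i ∈ M.upa v) : v = W :=
  hW.eq_of_bidir hz hv ⟨fun h => hv (h ▸ hz), i, hiz, hiv⟩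

variable (M Z W) in
/-- The model on the complement of `Z` in which the functions of the members of `Z` are
substituted into the function of `W`. -/
noncomputable abbrev marginal [∀ v, Countable (Ω v)] (x : ∀ v, Ω v)
    (hW : M.graph.ConnectedOnlyThrough Z W) : SemiMarkovianModel (fun v : ↥Zᶜ => Ω v) where
  U := M.U
  N := M.N
  law := M.law
  pa v := {p | p.1 ∈ M.pa v}
  upa v := M.margUpa Z W v
  f v a n := M.f v (M.margParents Z W x v a n) fun i => n ⟨i, Or.inl i.2⟩
  measurable_f v a w := by
    have : {n | M.f v (M.margParents Z W x v a n) (fun i => n ⟨i, Or.inl i.2⟩) = w} =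
        ⋃ b : ∀ p : M.pa v, Ω p,
          (⋂ p : M.pa v, {n | M.margParents Z W x v a n p = b p}) ∩
            (fun (n : ∀ i : M.margUpa Z W v, M.N i) (i : M.upa v) => n ⟨i, Or.inl i.2⟩) ⁻¹'
              {n | M.f v b n = w} := by
      ext n
      simp only [mem_ofPred_eq, mem_iUnion, mem_inter_iff, mem_iInter, mem_preimage]
      constructor
      · exact fun h => ⟨_, fun _ => rfl, h⟩
      · rintro ⟨a, ha, h⟩
        rwa [funext ha]
    rw [this]
    refine MeasurableSet.iUnion fun b => MeasurableSet.inter (MeasurableSet.iInter fun p => ?_)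
      ((measurable_pi_lambda _ fun i => measurable_pi_apply _) (M.measurable_f v b w))
    by_cases h : p.1 ∈ Z
    · simp only [margParents, dif_pos h]
      exact M.measurable_extendNoise _ (M.measurableSet_solution ∅ x p (b p))
    · simp only [margParents, dif_neg h]
      exact MeasurableSet.const _
  upa_card i := by
    by_cases hi : ∃ z ∈ Z, i ∈ M.upa z
    -- Noise used inside `Z` can be used outside only by `W`, so after the substitution it has at
    -- most one user.
    · obtain ⟨z, hz, hiz⟩ := hi
      have hsub : {v : ↥Zᶜ | i ∈ M.margUpa Z W v} ⊆ {⟨W, hW.1⟩} := by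
        rintro ⟨v, hv⟩ (h | h)
        · exact Subtype.ext (eq_of_mem_upa_of_mem_upa hW hz hv hiz h)
        · exact Subtype.ext h.1
      exact (encard_le_encard hsub).trans (by simp)
    · rw [← Subtype.val_injective.encard_image]
      refine (encard_le_encard ?_).trans (M.upa_card i)
      rintro _ ⟨v, h | h, rfl⟩
      · exact h
      · exact absurd h.2 hi
  acyclic v h := M.acyclic v
    (Relation.TransGen.lift (r := fun a b : ↥Zᶜ => a.1 ∈ M.pa b)
      (p := fun a b => a ∈ M.pa b) Subtype.val (fun _ _ h => h) v v h)

/-- The noise that `W` takes over from `Z` has no other user outside `Z`, so no bidirected edge is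
created. -/
theorem marginal_graph [∀ v, Countable (Ω v)] (x : ∀ v, Ω v)
    (hW : M.graph.ConnectedOnlyThrough Z W) :
    (M.marginal Z W x hW).graph = M.graph.induce Zᶜ := by
  ext a b
  · rfl
  · change (a ≠ b ∧ ∃ i, i ∈ M.margUpa Z W a ∧ i ∈ M.margUpa Z W b) ↔
      (a.1 ≠ b.1 ∧ ∃ i, i ∈ M.upa a ∧ i ∈ M.upa b)
    rw [Ne, Ne, Subtype.ext_iff]
    refine and_congr_right fun hab => exists_congr fun i =>
      ⟨?_, fun h => ⟨Or.inl h.1, Or.inl h.2⟩⟩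
    rintro ⟨ha | ⟨ha, z, hz, hi⟩, hb | ⟨hb, z', hz', hi'⟩⟩
    · exact ⟨ha, hb⟩
    · exact absurd ((eq_of_mem_upa_of_mem_upa hW hz' a.2 hi' ha).trans hb.symm) hab
    · exact absurd (ha.trans (eq_of_mem_upa_of_mem_upa hW hz b.2 hi hb).symm) hab
    · exact absurd (ha.trans hb.symm) hab

theorem marginal_solution [∀ v, Countable (Ω v)] (x₀ : ∀ v, Ω v)
    (hW : M.graph.ConnectedOnlyThrough Z W) (hpa : ∀ z ∈ Z, M.pa z ⊆ Z) {X : Set V}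
    (hX : Disjoint Z X) (x : ∀ v, Ω v) (n : ∀ i, M.N i) (v : ↥Zᶜ) :
    (M.marginal Z W x₀ hW).solution (Subtype.val ⁻¹' X) (fun i => x i) n v =
      M.solution X x n v := by
  induction v using (M.marginal Z W x₀ hW).wellFounded_pa.induction with
  | h v ih =>
    by_cases hv : v.1 ∈ X
    · rw [M.solution_of_mem hv, solution_of_mem _ (show v ∈ Subtype.val ⁻¹' X from hv)]
    · rw [M.solution_of_notMem hv, solution_of_notMem _ (show v ∉ Subtype.val ⁻¹' X from hv)]
      change M.f v (M.margParents Z W x₀ v _ _) _ = _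
      congr 1
      funext p
      by_cases hp : p.1 ∈ Z
      · rw [margParents, dif_pos hp]
        refine M.solution_congr hpa (disjoint_empty _) hX (fun z hz i hi => ?_) p hp
        -- A child of `Z` outside `Z` is `W`, whose noise arguments include all noise of `Z`; the
        -- arbitrary values in `extendNoise` therefore never reach the solution on `Z`.
        have hmem : i ∈ M.margUpa Z W v := Or.inr ⟨hW.eq_of_dir hp v.2 p.2, z, hz, hi⟩
        rw [extendNoise, dif_pos hmem]
      · rw [margParents, dif_neg hp]
        exact ih ⟨p.1, hp⟩ p.2

theorem marginal_effect [∀ v, Countable (Ω v)] (x₀ : ∀ v, Ω v)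
    (hW : M.graph.ConnectedOnlyThrough Z W) (hpa : ∀ z ∈ Z, M.pa z ⊆ Z) {X : Set V}
    (hX : Disjoint Z X) (hY : Disjoint Z Y) (x y : ∀ v, Ω v) :
    (M.marginal Z W x₀ hW).effect (Subtype.val ⁻¹' X) (fun i => x i) (Subtype.val ⁻¹' Y)
      (fun i => y i) = M.effect X x Y y := by
  change M.noise _ = M.noise _
  congr 1
  ext n
  simp only [mem_ofPred_eq, marginal_solution x₀ hW hpa hX]
  exact ⟨fun h v hv => h ⟨v, hY.notMem_of_mem_right hv⟩ hv, fun h v hv => h v hv⟩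

theorem marginal_obs [∀ v, Countable (Ω v)] (x₀ : ∀ v, Ω v)
    (hW : M.graph.ConnectedOnlyThrough Z W) (hpa : ∀ z ∈ Z, M.pa z ⊆ Z) (v : ∀ v, Ω v) :
    (M.marginal Z W x₀ hW).obs univ (fun i => v i) = M.obs Zᶜ v := by
  rw [obs, obs, ← marginal_effect x₀ hW hpa (disjoint_empty Z) disjoint_compl_right]
  congr 1
  ext a
  simp

end Marginal

/-! ### Adjoining independent variables on `Z` -/

section Extension

variable (G : SMG V) (Z : Set V) (M : SemiMarkovianModel (fun v : ↥Zᶜ => Ω v))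

variable (V) in
/-- An index type, in the lowest universe, for the pairs of elements of a finite type. -/
abbrev PairIndex : Type := Fin (Nat.card V) × Fin (Nat.card V)

/-- The index of the pair `(a, b)`. -/
noncomputable def pairIndex (a b : V) : PairIndex V := (Finite.equivFin V a, Finite.equivFin V b)

/-- The indices of the pairs `(a, b)` such that `v` is `a` or `b` and such that either `a = b` is
in `Z` or `a ↔ b` is an edge that meets `Z`. -/
def incidentPairs (v : V) : Set (PairIndex V) :=
  {p | ∃ a b, p = pairIndex a b ∧ (v = a ∨ v = b) ∧ (a ∈ Z ∨ b ∈ Z) ∧ (a = b ∨ G.bidir a b)}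

theorem pairIndex_mem_incidentPairs {a b v : V} :
    pairIndex a b ∈ incidentPairs G Z v ↔
      (v = a ∨ v = b) ∧ (a ∈ Z ∨ b ∈ Z) ∧ (a = b ∨ G.bidir a b) := by
  constructor
  · rintro ⟨a', b', h, h'⟩
    simp only [pairIndex, Prod.mk.injEq, EmbeddingLike.apply_eq_iff_eq] at h
    obtain ⟨rfl, rfl⟩ := h
    exact h'
  · exact fun h => ⟨a, b, rfl, h⟩

theorem pairIndex_self_mem {z : V} (hz : z ∈ Z) : pairIndex z z ∈ incidentPairs G Z z :=
  (pairIndex_mem_incidentPairs G Z).mpr ⟨Or.inl rfl, Or.inl hz, Or.inl rfl⟩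

theorem encard_incidentPairs (p : PairIndex V) : {v | p ∈ incidentPairs G Z v}.encard ≤ 2 := by
  obtain ⟨a, b, rfl⟩ : ∃ a b : V, p = pairIndex a b :=
    ⟨(Finite.equivFin V).symm p.1, (Finite.equivFin V).symm p.2, by simp [pairIndex]⟩
  refine (encard_le_encard (t := {a, b}) fun v hv => ?_).trans ?_
  · exact ((pairIndex_mem_incidentPairs G Z).mp hv).1
  · exact (encard_insert_le _ _).trans_eq (by rw [encard_singleton, one_add_one_eq_two])

/-- The unobserved arguments of `v` in the extended model. -/
def extUpa (v : V) : Set (M.U ⊕ PairIndex V) :=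
  {i | Sum.elim (fun i => ∃ h : v ∈ Zᶜ, i ∈ M.upa ⟨v, h⟩) (fun p => p ∈ incidentPairs G Z v) i}

/-- The noise spaces of the extended model. -/
def extN (S : Type) : M.U ⊕ PairIndex V → Type
  | Sum.inl i => M.N i
  | Sum.inr _ => S

instance extNMeasurableSpace (S : Type) [MeasurableSpace S] :
    ∀ i, MeasurableSpace (extN Z M S i)
  | Sum.inl i => M.measurableN i
  | Sum.inr _ => inferInstanceAs (MeasurableSpace S)

/-- The noise distributions of the extended model. -/
noncomputable def extLaw {S : Type} [MeasurableSpace S] (ρ : Measure S) :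
    ∀ i, Measure (extN Z M S i)
  | Sum.inl i => M.law i
  | Sum.inr _ => ρ

instance extLaw_isProbabilityMeasure {S : Type} [MeasurableSpace S] (ρ : Measure S)
    [IsProbabilityMeasure ρ] : ∀ i, IsProbabilityMeasure (extLaw Z M ρ i)
  | Sum.inl i => M.probLaw i
  | Sum.inr _ => inferInstanceAs (IsProbabilityMeasure ρ)

open Classical in
/-- The functions of the extended model: a variable in `Z` is a function of its private noise, and
the other variables are determined as in `M`. -/
noncomputable def extF {S : Type} (g : ∀ v, S → Ω v) (hM : M.graph = G.induce Zᶜ) (v : V)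
    (a : ∀ p : {p | G.dir p v}, Ω p) (n : ∀ i : extUpa G Z M v, extN Z M S i) : Ω v :=
  if h : v ∈ Z then g v (n ⟨Sum.inr (pairIndex v v), pairIndex_self_mem G Z h⟩)
  else M.f ⟨v, h⟩
    (fun p => a ⟨p.1.1, (congrArg (fun H => H.dir p.1 ⟨v, h⟩) hM).mp p.2⟩)
    (fun i => n ⟨Sum.inl i, h, i.2⟩)

/-- An extension of a model on the complement of `Z` to all variables: the members of `Z` are
independent of everything else, and the other variables ignore them. -/
noncomputable abbrev extension {S : Type} [MeasurableSpace S] [DiscreteMeasurableSpace S]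
    (ρ : Measure S) [IsProbabilityMeasure ρ] (g : ∀ v, S → Ω v)
    (hM : M.graph = G.induce Zᶜ) : SemiMarkovianModel Ω where
  U := M.U ⊕ PairIndex V
  N := extN Z M S
  law := extLaw Z M ρ
  pa v := {p | G.dir p v}
  upa := extUpa G Z M
  f := extF G Z M g hM
  measurable_f v a w := by
    by_cases h : v ∈ Z
    · simp only [extF, dif_pos h]
      exact (show Measurable fun n : ∀ i : extUpa G Z M v, extN Z M S i =>
        (n ⟨Sum.inr (pairIndex v v), pairIndex_self_mem G Z h⟩ : S) from measurable_pi_apply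
          (⟨Sum.inr (pairIndex v v), pairIndex_self_mem G Z h⟩ : extUpa G Z M v))
        (MeasurableSet.of_discrete (s := {s : S | g v s = w}))
    · simp only [extF, dif_neg h]
      exact (measurable_pi_lambda (fun (n : ∀ i : extUpa G Z M v, extN Z M S i)
        (i : M.upa ⟨v, h⟩) => (n ⟨Sum.inl i, h, i.2⟩ : M.N i)) fun i =>
          measurable_pi_apply (⟨Sum.inl i, h, i.2⟩ : extUpa G Z M v)) (M.measurable_f ⟨v, h⟩ _ w)
  upa_card i := by
    rcases i with i | p
    · refine le_trans (encard_le_encard ?_)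
        ((encard_image_le Subtype.val {v | i ∈ M.upa v}).trans (M.upa_card i))
      rintro v ⟨h, hi⟩
      exact ⟨⟨v, h⟩, hi, rfl⟩
    · exact encard_incidentPairs G Z p
  acyclic := G.acyclic

variable {G Z M} {S : Type} [MeasurableSpace S] [DiscreteMeasurableSpace S]
  {ρ : Measure S} [IsProbabilityMeasure ρ] {g : ∀ v, S → Ω v}

/-- Bidirected edges outside `Z` come from the noise of `M`. Those meeting `Z` come from
off-diagonal pair indices, which are formal arguments that no function actually reads. A diagonal
index belongs to a single vertex and adds no edge. -/
theorem extension_graph (hM : M.graph = G.induce Zᶜ) : (extension G Z M ρ g hM).graph = G := by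
  have hbi : ∀ a b : ↥Zᶜ, (a ≠ b ∧ ∃ i, i ∈ M.upa a ∧ i ∈ M.upa b) ↔ G.bidir a b := fun a b =>
    iff_of_eq (congrArg (fun H => H.bidir a b) hM)
  ext a b
  · rfl
  · change (a ≠ b ∧ ∃ i, i ∈ extUpa G Z M a ∧ i ∈ extUpa G Z M b) ↔ _
    constructor
    · rintro ⟨hab, i | _, ha, hb⟩
      · obtain ⟨ha, hia⟩ := ha
        obtain ⟨hb, hib⟩ := hb
        exact (hbi ⟨a, ha⟩ ⟨b, hb⟩).mp ⟨fun h => hab (congrArg Subtype.val h), i, hia, hib⟩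
      · obtain ⟨c, d, rfl, hac, -, hcd⟩ := ha
        have hbc := ((pairIndex_mem_incidentPairs G Z).mp hb).1
        rcases hac with rfl | rfl <;> rcases hbc with rfl | rfl
        · exact absurd rfl hab
        · exact hcd.resolve_left hab
        · exact G.bidir_symm _ _ (hcd.resolve_left (Ne.symm hab))
        · exact absurd rfl hab
    · intro h
      refine ⟨fun e => G.bidir_irrefl a (e ▸ h), ?_⟩
      by_cases hZ : a ∈ Z ∨ b ∈ Z
      · exact ⟨Sum.inr (pairIndex a b),
          (pairIndex_mem_incidentPairs G Z).mpr ⟨Or.inl rfl, hZ, Or.inr h⟩,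
          (pairIndex_mem_incidentPairs G Z).mpr ⟨Or.inr rfl, hZ, Or.inr h⟩⟩
      · rw [not_or] at hZ
        obtain ⟨-, i, hi⟩ := (hbi ⟨a, hZ.1⟩ ⟨b, hZ.2⟩).mpr h
        exact ⟨Sum.inl i, ⟨hZ.1, hi.1⟩, ⟨hZ.2, hi.2⟩⟩

variable (Z M) in
/-- The values of the unobserved variables of the original model. -/
def inlNoise (n : ∀ i, extN Z M S i) (i : M.U) : M.N i := n (Sum.inl i)

variable (Z M) in
/-- The values of the additional unobserved variables. -/
def inrNoise (n : ∀ i, extN Z M S i) (p : PairIndex V) : S := n (Sum.inr p)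

theorem extension_solution_of_mem (hM : M.graph = G.induce Zᶜ) {X : Set V} (hX : Disjoint Z X)
    (x : ∀ v, Ω v) (n : ∀ i, extN Z M S i) {z : V} (hz : z ∈ Z) :
    (extension G Z M ρ g hM).solution X x n z = g z (inrNoise Z M n (pairIndex z z)) :=
  (solution_of_notMem (extension G Z M ρ g hM) (hX.notMem_of_mem_left hz) x n).trans (dif_pos hz)

theorem extension_solution (hM : M.graph = G.induce Zᶜ) (X : Set V)
    (x : ∀ v, Ω v) (n : ∀ i, extN Z M S i) (v : ↥Zᶜ) :
    (extension G Z M ρ g hM).solution X x n v =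
      M.solution (Subtype.val ⁻¹' X) (fun i => x i) (inlNoise Z M n) v := by
  induction v using M.wellFounded_pa.induction with
  | h v ih =>
    by_cases hv : v.1 ∈ X
    · rw [solution_of_mem _ hv, M.solution_of_mem (show v ∈ Subtype.val ⁻¹' X from hv)]
    · rw [M.solution_of_notMem (show v ∉ Subtype.val ⁻¹' X from hv)]
      refine ((solution_of_notMem (extension G Z M ρ g hM) hv x n).trans (dif_neg v.2)).trans ?_
      exact congrArg (fun a => M.f v a fun i => inlNoise Z M n i) (funext fun p => ih p.1 p.2)

omit [Finite V] [DiscreteMeasurableSpace S] in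
theorem pi_extLaw (A : Set (∀ i, M.N i)) (B : Set (PairIndex V → S)) :
    Measure.pi (extLaw Z M ρ) {n | inlNoise Z M n ∈ A ∧ inrNoise Z M n ∈ B} =
      M.noise A * Measure.pi (fun _ => ρ) B := by
  -- A measurable equivalence and the product formula for rectangles need no measurability of `A`
  -- and `B`.
  have := (measurePreserving_sumPiEquivProdPi (extLaw Z M ρ)).measure_preimage_equiv (A ×ˢ B)
  exact this.trans (Measure.prod_prod (μ := Measure.pi M.law)
    (ν := Measure.pi fun _ : PairIndex V => ρ) A B)

theorem extension_effect (hM : M.graph = G.induce Zᶜ) {X Y : Set V} (hY : Disjoint Z Y)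
    (x y : ∀ v, Ω v) :
    (extension G Z M ρ g hM).effect X x Y y =
      M.effect (Subtype.val ⁻¹' X) (fun i => x i) (Subtype.val ⁻¹' Y) (fun i => y i) := by
  have h := pi_extLaw (Z := Z) (M := M) (ρ := ρ)
    {n | ∀ v ∈ Subtype.val ⁻¹' Y, M.solution (Subtype.val ⁻¹' X) (fun i => x i) n v = y v} univ
  rw [measure_univ, mul_one] at h
  refine Eq.trans (congrArg (Measure.pi (extLaw Z M ρ)) (Set.ext fun n => ?_)) h
  constructor
  · exact fun h => ⟨fun v hv => (extension_solution hM X x n v).symm.trans (h v hv), mem_univ _⟩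
  · exact fun h v hv => (extension_solution hM X x n ⟨v, hY.notMem_of_mem_right hv⟩).trans
      (h.1 ⟨v, hY.notMem_of_mem_right hv⟩ hv)

/-- The old and the added noise are independent. The second factor does not involve the functions or
laws of `M`, so extending two models preserves equality of their observed laws. -/
theorem extension_obs (hM : M.graph = G.induce Zᶜ) (v : ∀ v, Ω v) :
    (extension G Z M ρ g hM).obs univ v = M.obs univ (fun i => v i) *
      Measure.pi (fun _ => ρ) {n | ∀ z ∈ Z, g z (n (pairIndex z z)) = v z} := by
  refine Eq.trans (congrArg (Measure.pi (extLaw Z M ρ)) (Set.ext fun n => ?_))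
    (pi_extLaw (Z := Z) (M := M) (ρ := ρ) _ _)
  have hmem := fun z (hz : z ∈ Z) =>
    extension_solution_of_mem (ρ := ρ) (g := g) hM (disjoint_empty Z) v n hz
  have hnotMem := extension_solution (ρ := ρ) (g := g) hM ∅ v n
  rw [preimage_empty] at hnotMem
  constructor
  · exact fun h => ⟨fun u _ => (hnotMem u).symm.trans (h u (mem_univ _)),
      fun z hz => (hmem z hz).symm.trans (h z (mem_univ _))⟩
  · intro h u _
    by_cases hu : u ∈ Z
    · exact (hmem u hu).trans (h.2 u hu)
    · exact (hnotMem ⟨u, hu⟩).trans (h.1 ⟨u, hu⟩ (mem_univ _))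

omit [DiscreteMeasurableSpace S] in
theorem pi_private_noise_pos (hρ : ∀ s, 0 < ρ {s}) (hg : ∀ z ∈ Z, Function.Surjective (g z))
    (v : ∀ v, Ω v) :
    0 < Measure.pi (fun _ : PairIndex V => ρ) {n | ∀ z ∈ Z, g z (n (pairIndex z z)) = v z} := by
  have hs : ∀ u : V, ∃ s : S, u ∈ Z → g u s = v u := fun u => by
    by_cases hu : u ∈ Z
    · exact (hg u hu (v u)).imp fun s hs _ => hs
    · exact ⟨(nonempty_of_isProbabilityMeasure ρ).some, fun h => absurd h hu⟩
  choose s hs using hs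
  -- One noise point of positive mass suffices; only its diagonal entries matter, so the second
  -- index is ignored.
  let n : PairIndex V → S := fun p => s ((Finite.equivFin V).symm p.1)
  refine lt_of_lt_of_le (b := Measure.pi (fun _ : PairIndex V => ρ) {n}) ?_ (measure_mono ?_)
  · rw [Measure.pi_singleton]
    exact pos_iff_ne_zero.mpr (Finset.prod_ne_zero_iff.mpr fun p _ => (hρ _).ne')
  · rintro _ rfl z hz
    simpa [n, pairIndex] using hs z hz

end Extension

end SemiMarkovianModel

/-! ### Transfer of identifiability -/

open SemiMarkovianModel

theorem exists_marginal_model {V : Type u} [Finite V] {G : SMG V} {X Y Z : Set V} {W : V}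
    (hAn : G.An Y = univ) (hZ : Disjoint Z (X ∪ Y)) (hW : G.ConnectedOnlyThrough Z W)
    {Ω : V → Type} [∀ v, Countable (Ω v)] [∀ v, Nonempty (Ω v)] (M : SemiMarkovianModel Ω)
    (hM : M.graph = G) :
    ∃ M' : SemiMarkovianModel (fun v : ↥Zᶜ => Ω v),
      M'.graph = G.induce Zᶜ ∧
      (∀ v : (∀ i, Ω i), M'.obs univ (fun i => v i) = M.obs Zᶜ v) ∧
      ∀ x y : (∀ i, Ω i),
        M.effect X x Y y =
          M'.effect (Subtype.val ⁻¹' X) (fun i => x i) (Subtype.val ⁻¹' Y) (fun i => y i) := by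
  subst hM
  rw [disjoint_union_right] at hZ
  have hpa : ∀ z ∈ Z, M.pa z ⊆ Z := fun z hz p hp => hW.mem_of_dir hAn hZ.2 hz hp
  -- This only fills the value slot of an empty intervention.
  have x₀ : ∀ v, Ω v := fun v => Classical.arbitrary _
  exact ⟨M.marginal Z W x₀ hW, marginal_graph x₀ hW, marginal_obs x₀ hW hpa,
    fun x y => (marginal_effect x₀ hW hpa hZ.1 hZ.2 x y).symm⟩

theorem exists_restrict_eq {V : Type u} (Z : Set V) {Ω : V → Type} [∀ v, Nonempty (Ω v)]
    (w : ∀ v : ↥Zᶜ, Ω v) : ∃ w' : (∀ v, Ω v), (fun v : ↥Zᶜ => w' v) = w := by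
  classical
  exact ⟨fun v => if h : v ∈ Zᶜ then w ⟨v, h⟩ else Classical.arbitrary _,
    funext fun v => dif_pos v.2⟩

/-- A family of domains on the complement of `Z` extends to `V`, with two values in `Z`. -/
theorem exists_extended_domains {V : Type u} (Z : Set V) (Ω' : ↥Zᶜ → Type)
    [∀ v, Countable (Ω' v)] [∀ v, Nonempty (Ω' v)] :
    ∃ Ω : V → Type, (∀ v, Countable (Ω v)) ∧ (∀ v, Nonempty (Ω v)) ∧
      Ω' = (fun v : ↥Zᶜ => Ω v) ∧ ∀ z ∈ Z, Ω z = Bool := by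
  classical
  refine ⟨fun v => if h : v ∈ Z then Bool else Ω' ⟨v, h⟩, fun v => ?_, fun v => ?_, ?_,
    fun z hz => dif_pos hz⟩
  · by_cases h : v ∈ Z
    · simp only [dif_pos h]
      infer_instance
    · simp only [dif_neg h]
      infer_instance
  · by_cases h : v ∈ Z
    · simp only [dif_pos h]
      infer_instance
    · simp only [dif_neg h]
      infer_instance
  · funext v
    have hv : v.1 ∉ Z := v.2
    simp only [dif_neg hv]

theorem Identifiable.induce_compl {V : Type u} [Finite V] {G : SMG V} {X Y Z : Set V}
    (hY : Disjoint Z Y) (hG : Identifiable G X Y) :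
    Identifiable (G.induce Zᶜ) (Subtype.val ⁻¹' X) (Subtype.val ⁻¹' Y) := by
  intro Ω' _ _ M₁ M₂ h₁ h₂ hpos heq x y
  -- Substituting the equality of families makes the domains literally a restriction of `Ω`, so both
  -- models can be extended without casts.
  obtain ⟨Ω, _, _, rfl, hΩ⟩ := exists_extended_domains Z Ω'
  have hg : ∀ v, ∃ g : Bool → Ω v, v ∈ Z → Function.Surjective g := fun v => by
    by_cases hv : v ∈ Z
    · exact ⟨cast (hΩ v hv).symm, fun _ => (cast_bijective _).surjective⟩
    · exact ⟨fun _ => Classical.arbitrary _, fun h => absurd h hv⟩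
  choose g hg using hg
  let ρ : Measure Bool := (PMF.uniformOfFintype Bool).toMeasure
  have hρ : ∀ s, 0 < ρ {s} := fun s => by
    rw [PMF.toMeasure_apply_singleton _ _ (MeasurableSet.singleton s)]
    simp
  obtain ⟨x, rfl⟩ := exists_restrict_eq Z x
  obtain ⟨y, rfl⟩ := exists_restrict_eq Z y
  rw [← extension_effect (ρ := ρ) (g := g) h₁ hY, ← extension_effect (ρ := ρ) (g := g) h₂ hY]
  refine hG Ω _ _ (extension_graph h₁) (extension_graph h₂) (fun v => ?_) (fun v => ?_) x y
  · rw [extension_obs]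
    exact ENNReal.mul_pos (hpos _).ne' (pi_private_noise_pos hρ hg v).ne'
  · rw [extension_obs, extension_obs, heq]

/-- The marginal model of `M` has the same observed law as `M'` and the same effect as `M`, so
identifiability on the complement compares it with `M'`. -/
theorem Identifiable.of_induce_compl {V : Type u} [Finite V] {G : SMG V} {X Y Z : Set V} {W : V}
    (hAn : G.An Y = univ) (hZ : Disjoint Z (X ∪ Y)) (hW : G.ConnectedOnlyThrough Z W)
    (hG : Identifiable (G.induce Zᶜ) (Subtype.val ⁻¹' X) (Subtype.val ⁻¹' Y)) {Ω : V → Type}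
    [∀ v, Countable (Ω v)] [∀ v, Nonempty (Ω v)] {M : SemiMarkovianModel Ω}
    {M' : SemiMarkovianModel (fun v : ↥Zᶜ => Ω v)} (hM : M.graph = G)
    (hM' : M'.graph = G.induce Zᶜ) (hpos : ∀ v, 0 < M.obs univ v)
    (hobs : ∀ v : (∀ i, Ω i), M'.obs univ (fun i => v i) = M.obs Zᶜ v) (x y : ∀ v, Ω v) :
    M.effect X x Y y =
      M'.effect (Subtype.val ⁻¹' X) (fun i => x i) (Subtype.val ⁻¹' Y) (fun i => y i) := by
  obtain ⟨N, hN, hNobs, hNeff⟩ := exists_marginal_model hAn hZ hW M hM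
  rw [hNeff]
  refine hG _ N M' hN hM' (fun w => ?_) (fun w => ?_) _ _ <;>
    obtain ⟨v, rfl⟩ := exists_restrict_eq Z w
  · rw [hNobs]
    exact (hpos v).trans_le (M.obs_univ_le _ v)
  · rw [hNobs, hobs]

theorem mainTheorem4 {V : Type u} [Finite V] (G : SMG V) (X Y Z : Set V) (W : V)
    (hXY : Disjoint X Y) (hAn : G.An Y = univ) (hZ : Disjoint Z (X ∪ Y))
    (hW : G.ConnectedOnlyThrough Z W) :
    -- every model inducing `G` has a counterpart inducing `G[V \ Z]`, with the observational
    -- distribution `P(V \ Z)` and the same causal effect of `X` on `Y`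
    (∀ (Ω : V → Type) [∀ v, Countable (Ω v)] [∀ v, Nonempty (Ω v)] (M : SemiMarkovianModel Ω),
      M.graph = G →
      ∃ M' : SemiMarkovianModel (fun v : ↥Zᶜ => Ω v),
        M'.graph = G.induce Zᶜ ∧
        (∀ v : (∀ i, Ω i), M'.obs univ (fun i => v i) = M.obs Zᶜ v) ∧
        ∀ x y : (∀ i, Ω i),
          M.effect X x Y y =
            M'.effect (Subtype.val ⁻¹' X) (fun i => x i) (Subtype.val ⁻¹' Y) (fun i => y i)) ∧
    -- the effect is identifiable from `P` in `G` iff it is so from `P(V \ Z)` in `G[V \ Z]`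
    (Identifiable G X Y ↔
      Identifiable (G.induce Zᶜ) (Subtype.val ⁻¹' X) (Subtype.val ⁻¹' Y)) ∧
    -- and then the value determined by `P` in `G` is the one determined by `P(V \ Z)`
    -- in `G[V \ Z]`
    (Identifiable G X Y →
      ∀ (Ω : V → Type) [∀ v, Countable (Ω v)] [∀ v, Nonempty (Ω v)]
        (M : SemiMarkovianModel Ω) (M' : SemiMarkovianModel (fun v : ↥Zᶜ => Ω v)),
        M.graph = G → M'.graph = G.induce Zᶜ →
        (∀ v, 0 < M.obs univ v) →
        (∀ v : (∀ i, Ω i), M'.obs univ (fun i => v i) = M.obs Zᶜ v) →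
        ∀ x y : (∀ i, Ω i),
          M.effect X x Y y =
            M'.effect (Subtype.val ⁻¹' X) (fun i => x i) (Subtype.val ⁻¹' Y)
              (fun i => y i)) := by
  have hback := fun hG => @Identifiable.of_induce_compl V _ G X Y Z W hAn hZ hW hG
  have hforth : Identifiable G X Y → _ :=
    Identifiable.induce_compl (disjoint_union_right.mp hZ).2
  refine ⟨fun Ω _ _ M hM => exists_marginal_model hAn hZ hW M hM, ⟨hforth, fun hG => ?_⟩,
    fun hG Ω _ _ M M' hM hM' => hback (hforth hG) hM hM'⟩
  intro Ω _ _ M₁ M₂ h₁ h₂ hpos heq x y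
  -- It is enough to marginalise `M₂`: the result serves as the model on the complement with which
  -- `M₁` is compared.
  obtain ⟨N, hN, hNobs, hNeff⟩ := exists_marginal_model hAn hZ hW M₂ h₂
  rw [hNeff]
  exact hback hG h₁ hN hpos (fun v => (hNobs v).trans (obs_congr heq Zᶜ v).symm) x y
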